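/- Let $n\ge 1$. On $n$ qubits let $\sigma^x_u,\sigma^z_u$ be the Pauli operators on qubit $u$, and let $H=n^{-1}H_{\mathrm{Ising}}$ with $H_{\mathrm{Ising}}=\sum_{u<v}\sigma^z_u\sigma^z_v$. Let $C=\sum_{u<v}c_{uv}\sigma^z_u\sigma^z_v$ and $C'=\sum_{u<v}c'_{uv}\sigma^z_u\sigma^z_v$ with real symmetric weights $c_{uv},c'_{uv}$. A compilation of $C'$ is a finite sequence of bit flips $\sigma^x_u$ and pulses, where a pulse $p$ with sign $s_p\in\{\pm1\}$ and duration $\tau_p\ge 0$ is an evolution for time $\tau_p$ under $s_pH$, such that every qubit is flipped an even number of times in total and $$C'=\sum_p s_p\,\tau_p\, n^{-1}\sum_{u<v}(-1)^{\mathbf 1_{S_p}(u)+\mathbf 1_{S_p}(v)}\sigma^z_u\sigma^z_v ,$$ where $S_p$ is the set of qubits that have been flipped an odd number of times before pulse $p$. (The sequences of pulses and bit flips produced by the union-of-stars algorithm are compilations in this sense.) Its total time is $T=\sum_p\tau_p$. Fix a compilation of $C'$, a dephasing rate $\Gamma\ge 0$, and angles $\gamma\ge 0$ and $\beta\in\mathbb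 R$, and put $t=\gamma T$. Single-layer QAOA starts in $|+\rangle^{\otimes n}$, executes the compilation with every pulse duration multiplied by $\gamma$, and then applies the noiseless unitary $e^{-i\beta B}$, $B=\sum_u\sigma^x_u$. Bit flips are instantaneous and noiseless, $\rho\mapsto\sigma^x_u\rho\,\sigma^x_u$; during a pulse of sign $s$ the density matrix follows the master equation $$\frac{d\rho}{dt}=-i\,s\,(H\rho-\rho H)-\sum_u\left(J_uJ_u^\dagger\rho-2J_u\rho J_u^\dagger+\rho J_uJ_u^\dagger\right),\qquad J_u=\sqrt{\Gamma/8}\;\sigma^z_u .$$ Then the final density matrix $\rho$ exists and is unique, and $\langle C\rangle=\operatorname{Tr}(C\rho)$ is $$\begin{aligned}\langle C\rangle={}&\sum_{u<v}\frac{c_{uv}\sin(4\beta)\sin(2\gamma c'_{uv})\,e^{-\Gamma t/2}}{2}\left(\prod_{\mu\ne u,v}\cos(2\gamma c'_{\mu v})+\prod_{\mu\ne u,v}\cos(2\gamma c'_{\mu u})\right)\\&-\sum_{u<v}\frac{c_{uv}\sin^2(2\beta)\,e^{-\Gamma t}}{2}\left(\prod_{\mu\ne u,v}\cos\bigl(2\gamma(c'_{\mu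 u}+c'_{\mu v})\bigr)-\prod_{\mu\ne u,v}\cos\bigl(2\gamma(c'_{\mu u}-c'_{\mu v})\bigr)\right).\end{aligned}$$ -/

import Mathlib

open scoped NNReal Matrix

noncomputable section

namespace DephasedQAOA

/-- Operators on `n` qubits, as matrices in the computational basis `|z⟩`, `z : Fin n → Fin 2`. -/
abbrev Operator (n : ℕ) : Type := Matrix (Fin n → Fin 2) (Fin n → Fin 2) ℂ

/-- The single-qubit operator `A` acting on qubit `u`, tensored with the identity elsewhere. -/
def onQubit {n : ℕ} (A : Matrix (Fin 2) (Fin 2) ℂ) (u : Fin n) : Operator n :=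
  Matrix.of fun z w => if ∀ v, v ≠ u → z v = w v then A (z u) (w u) else 0

/-- Pauli `X` on qubit `u`. -/
def sigmaX {n : ℕ} (u : Fin n) : Operator n := onQubit !![0, 1; 1, 0] u

/-- Pauli `Z` on qubit `u`. -/
def sigmaZ {n : ℕ} (u : Fin n) : Operator n := onQubit !![1, 0; 0, -1] u

/-- The graph coupling operator `∑_{u<v} c_{uv} Z_u Z_v`. The weight of an unordered pair that is
not an edge is `0`; weights of diagonal pairs are not used. -/
def couplingOp {n : ℕ} (c : Sym2 (Fin n) → ℝ) : Operator n :=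
  ∑ u : Fin n, ∑ v ∈ Finset.Ioi u, (c s(u, v) : ℂ) • (sigmaZ u * sigmaZ v)

/-- `H_Ising = ∑_{u<v} Z_u Z_v`. -/
def isingOp (n : ℕ) : Operator n :=
  ∑ u : Fin n, ∑ v ∈ Finset.Ioi u, sigmaZ u * sigmaZ v

/-- The native Hamiltonian `H = n⁻¹ H_Ising`. -/
def nativeH (n : ℕ) : Operator n := (n : ℂ)⁻¹ • isingOp n

/-- `H_Ising` with the sign of `Z_u` changed for all `u ∈ S`. -/
def flippedIsingOp {n : ℕ} (S : Finset (Fin n)) : Operator n :=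
  ∑ u : Fin n, ∑ v ∈ Finset.Ioi u,
    ((-1 : ℂ) ^ ((if u ∈ S then 1 else 0) + (if v ∈ S then 1 else 0))) • (sigmaZ u * sigmaZ v)

/-! ### Compilations -/

/-- The elementary operations of a compilation: a bit flip of one qubit, or a global pulse of
duration `τ` under the Hamiltonian `s H`, where the sign `s = ±1` can be chosen. -/
inductive Op (n : ℕ) : Type
  | flip (u : Fin n) : Op n
  | pulse (s : ℤˣ) (τ : ℝ≥0) : Op n

/-- Sequences of operations; the head of the list is executed first. -/
abbrev Program (n : ℕ) : Type := List (Op n)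

/-- The set of qubits flipped an odd number of times, starting from `S`. -/
def netFlips {n : ℕ} : Finset (Fin n) → Program n → Finset (Fin n)
  | S, [] => S
  | S, Op.flip u :: P => netFlips (symmDiff S {u}) P
  | S, Op.pulse _ _ :: P => netFlips S P

/-- The coupling operator accumulated by a program when the qubits in `S` are currently flipped:
a pulse of sign `s` and duration `τ` adds
`s τ n⁻¹ ∑_{u<v} (-1)^(1_S(u) + 1_S(v)) Z_u Z_v`. -/
def accumulated {n : ℕ} : Finset (Fin n) → Program n → Operator n
  | _, [] => 0
  | S, Op.flip u :: P => accumulated (symmDiff S {u}) P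
  | S, Op.pulse s τ :: P =>
      (((s : ℤ) : ℂ) * ((τ : ℝ) : ℂ) * (n : ℂ)⁻¹) • flippedIsingOp S + accumulated S P

/-- `P` is a graph compilation of the coupling `C' = ∑_{u<v} c'_{uv} Z_u Z_v`: all bit flips are
undone at the end, and the accumulated coupling operator is `C'`. -/
def Compiles {n : ℕ} (P : Program n) (c' : Sym2 (Fin n) → ℝ) : Prop :=
  netFlips ∅ P = ∅ ∧ accumulated ∅ P = couplingOp c'

/-- The total time of a program, i.e. the sum of the durations of its pulses. -/
def totalTime {n : ℕ} : Program n → ℝ≥0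
  | [] => 0
  | Op.flip _ :: P => totalTime P
  | Op.pulse _ τ :: P => τ + totalTime P

/-- The program in which the duration of every pulse is multiplied by `γ`. -/
def scale {n : ℕ} (γ : ℝ≥0) : Program n → Program n
  | [] => []
  | Op.flip u :: P => Op.flip u :: scale γ P
  | Op.pulse s τ :: P => Op.pulse s (γ * τ) :: scale γ P

/-! ### Noisy execution -/

/-- The jump operator `J_u = √(Γ/8) Z_u`. -/
def jump {n : ℕ} (Γ : ℝ) (u : Fin n) : Operator n := (Real.sqrt (Γ / 8) : ℂ) • sigmaZ u

/-- The right-hand side of the dephasing master equation,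
`-i (H ρ - ρ H) - ∑_u (J_u J_u† ρ - 2 J_u ρ J_u† + ρ J_u J_u†)`. -/
def lindbladian {n : ℕ} (Γ : ℝ) (H ρ : Operator n) : Operator n :=
  -(Complex.I • (H * ρ - ρ * H)) -
    ∑ u : Fin n, (jump Γ u * (jump Γ u)ᴴ * ρ - (2 : ℂ) • (jump Γ u * ρ * (jump Γ u)ᴴ)
      + ρ * (jump Γ u * (jump Γ u)ᴴ))

/-- `r` solves the master equation with Hamiltonian `H` on the time interval `[0, T]`
(the derivative of a matrix-valued curve is taken entrywise). -/
def SolvesMasterEquation {n : ℕ} (Γ : ℝ) (H : Operator n) (T : ℝ) (r : ℝ → Operator n) : Prop :=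
  ∀ s ∈ Set.Icc 0 T, ∀ z w,
    HasDerivWithinAt (fun x => r x z w) (lindbladian Γ H (r s) z w) (Set.Icc 0 T) s

/-- `Executes Γ P ρ ρ'`: running `P` from the state `ρ` ends in the state `ρ'`. Bit flips are
instantaneous and noiseless; during a pulse the state follows the master equation. -/
def Executes {n : ℕ} (Γ : ℝ) : Program n → Operator n → Operator n → Prop
  | [], ρ, ρ' => ρ' = ρ
  | Op.flip u :: P, ρ, ρ' => Executes Γ P (sigmaX u * ρ * (sigmaX u)ᴴ) ρ'
  | Op.pulse s τ :: P, ρ, ρ' => ∃ r : ℝ → Operator n,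
      SolvesMasterEquation Γ (((s : ℤ) : ℂ) • nativeH n) τ r ∧ r 0 = ρ ∧ Executes Γ P (r τ) ρ'

/-! ### Single-layer QAOA -/

/-- The state vector `|+⟩^{⊗n}`. -/
def plusVec (n : ℕ) : (Fin n → Fin 2) → ℂ := fun _ => ∏ _i : Fin n, ((Real.sqrt 2 : ℂ))⁻¹

/-- The density matrix of `|+⟩^{⊗n}`. -/
def plusState (n : ℕ) : Operator n := Matrix.vecMulVec (plusVec n) (star (plusVec n))

/-- The mixer `e^{-iβB}`, `B = ∑_u X_u`. -/
def mixer (n : ℕ) (β : ℝ) : Operator n :=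
  NormedSpace.exp ((-(Complex.I * (β : ℂ))) • ∑ u : Fin n, (sigmaX u : Operator n))

/-- `ρ` is an output state of single-layer QAOA with angles `γ, β`, where the phase unitary
`e^{-iγC'}` is executed by the `γ`-scaled version of the program `P` with dephasing rate `Γ`. -/
def IsQAOAOutput {n : ℕ} (Γ : ℝ) (P : Program n) (γ : ℝ≥0) (β : ℝ) (ρ : Operator n) : Prop :=
  ∃ σ, Executes Γ (scale γ P) (plusState n) σ ∧ ρ = mixer n β * σ * (mixer n β)ᴴ

/-- The expectation value `Tr(A ρ)` of `A` in the state `ρ`. -/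
def expectation {n : ℕ} (A ρ : Operator n) : ℂ := (A * ρ).trace

end DephasedQAOA

end

/-!
Dephasing commutes with diagonal Hamiltonians and with bit flips, so a compiled program only
multiplies the matrix entry `⟨z|ρ|w⟩` by the phase `exp (-iγ(C'(z) - C'(w)))` and by one factor
`exp (-Γt/2)` for each qubit on which `z` and `w` differ. In the Heisenberg picture the mixer turns
`Z_u` into `(cos 2β + i sin 2β X_u) Z_u`, so `Tr(Z_u Z_v ρ)` is a combination of the four
correlations `Tr(X_S Z_u Z_v σ)` with `S = ∅, {u}, {v}, {u, v}` in the state `σ` before the mixer.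
These read off the entries of `σ` at Hamming distance `|S|`, whose damping is `exp (-Γt|S|/2)` and
whose phase only involves the edges that cross the cut between `S` and its complement. In the
uniform average over basis states the spins are independent, and averaging each phase over its own
spin leaves a cosine.
-/

noncomputable section

open scoped BigOperators

namespace DephasedQAOA

/-- The eigenvalue `±1` of Pauli `Z` on a computational basis state of one qubit, as a complex
number so that it can be used in matrix entries and exponents without coercions. -/
def spin (b : Fin 2) : ℂ := if b = 0 then 1 else -1

@[simp] theorem spin_zero : spin 0 = 1 := rfl

@[simp] theorem spin_one : spin 1 = -1 := rfl

theorem spin_eq_one_or_neg_one (b : Fin 2) : spin b = 1 ∨ spin b = -1 := by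
  fin_cases b <;> simp

theorem spin_add (a b : Fin 2) : spin (a + b) = spin a * spin b := by
  fin_cases a <;> fin_cases b <;> simp

theorem spin_mul_self (b : Fin 2) : spin b * spin b = 1 := by
  rcases spin_eq_one_or_neg_one b with h | h <;> simp [h]

theorem cos_mul_spin (θ : ℂ) (b : Fin 2) : Complex.cos (θ * spin b) = Complex.cos θ := by
  rcases spin_eq_one_or_neg_one b with h | h <;> simp [h]

theorem exp_neg_I_mul_spin (θ : ℂ) (b : Fin 2) :
    Complex.exp (-Complex.I * (θ * spin b)) =
      Complex.cos θ - Complex.I * Complex.sin θ * spin b := by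
  rw [show -Complex.I * (θ * spin b) = (-(θ * spin b)) * Complex.I by ring, Complex.exp_mul_I]
  rcases spin_eq_one_or_neg_one b with h | h <;> simp [h] <;> ring

theorem prod_cos_mul_spin_add_mul_spin {ι : Type*} (T : Finset ι) (f g : ι → ℂ) (a b : Fin 2) :
    ∏ i ∈ T, Complex.cos (f i * spin a + g i * spin b) =
      (1 + spin a * spin b) / 2 * ∏ i ∈ T, Complex.cos (f i + g i) +
        (1 - spin a * spin b) / 2 * ∏ i ∈ T, Complex.cos (f i - g i) := by
  have hcos : ∀ x y : ℂ, Complex.cos (-x + y) = Complex.cos (x - y) := fun x y => by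
    rw [← Complex.cos_neg]; ring_nf
  have hcos' : ∀ x y : ℂ, Complex.cos (-x - y) = Complex.cos (x + y) := fun x y => by
    rw [← Complex.cos_neg]; ring_nf
  fin_cases a <;> fin_cases b <;> simp [hcos, hcos', ← sub_eq_add_neg]

theorem sum_one_sub_spin_mul_spin {ι : Type*} [Fintype ι] (z w : ι → Fin 2) :
    ∑ u, (1 - spin (z u) * spin (w u)) = 2 * hammingDist z w := by
  have hterm (a b : Fin 2) : 1 - spin a * spin b = if a ≠ b then 2 else 0 := by
    fin_cases a <;> fin_cases b <;> norm_num
  simp only [hterm, hammingDist, Finset.sum_ite, Finset.sum_const, nsmul_eq_mul]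
  ring

section FlipBits

variable {ι : Type*} [DecidableEq ι]

/-- The permutation of the computational basis that flips the bits of the qubits in `S`. -/
def flipBits (S : Finset ι) : Equiv.Perm (ι → Fin 2) :=
  Function.Involutive.toPerm (fun z i => if i ∈ S then z i + 1 else z i) fun z => by
    funext i
    by_cases hi : i ∈ S <;> simp [hi, add_assoc]

theorem flipBits_apply (S : Finset ι) (z : ι → Fin 2) (i : ι) :
    flipBits S z i = if i ∈ S then z i + 1 else z i :=
  rfl

theorem flipBits_symm (S : Finset ι) : (flipBits S).symm = flipBits S :=
  Function.Involutive.toPerm_symm _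

theorem flipBits_empty : flipBits (∅ : Finset ι) = 1 := by
  ext z i
  simp [flipBits_apply]

theorem flipBits_mul_flipBits (S R : Finset ι) :
    flipBits S * flipBits R = flipBits (symmDiff S R) := by
  ext z i : 2
  by_cases hS : i ∈ S <;> by_cases hR : i ∈ R <;>
    simp [flipBits_apply, Finset.mem_symmDiff, hS, hR, add_assoc]

theorem flipBits_flipBits (S R : Finset ι) (z : ι → Fin 2) :
    flipBits S (flipBits R z) = flipBits (symmDiff S R) z :=
  congrArg (· z) (flipBits_mul_flipBits S R)

theorem spin_flipBits (S : Finset ι) (z : ι → Fin 2) (i : ι) :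
    spin (flipBits S z i) = (if i ∈ S then -1 else 1) * spin (z i) := by
  rw [flipBits_apply]
  split_ifs <;> simp [spin_add]

variable [Fintype ι]

theorem hammingDist_flipBits_flipBits (S : Finset ι) (z w : ι → Fin 2) :
    hammingDist (flipBits S z) (flipBits S w) = hammingDist z w :=
  hammingDist_comp (fun i b => if i ∈ S then b + 1 else b) fun i a b => by
    split_ifs <;> simp

theorem hammingDist_flipBits (S : Finset ι) (z : ι → Fin 2) :
    hammingDist z (flipBits S z) = S.card := by
  simp [hammingDist, flipBits_apply]

end FlipBits

section SpinAverages

variable {ι : Type*} [Fintype ι] [DecidableEq ι]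

theorem expect_mul_spin_eq_zero {G : (ι → Fin 2) → ℂ} {i : ι} (hG : DependsOn G {i}ᶜ) :
    𝔼 z, G z * spin (z i) = 0 := by
  have hflip (z : ι → Fin 2) : G (flipBits {i} z) = G z := hG fun j hj => by
    simp_all [flipBits_apply]
  refine self_eq_neg.mp ?_
  rw [← Finset.expect_neg_distrib]
  refine Fintype.expect_equiv (flipBits {i}) _ _ fun z => ?_
  simp [hflip, spin_flipBits]

theorem expect_spin_mul_spin {u v : ι} (huv : u ≠ v) :
    𝔼 z : ι → Fin 2, spin (z u) * spin (z v) = 0 :=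
  expect_mul_spin_eq_zero fun _ _ h => by rw [h u huv]

/-- Each spin in `T` enters only through its own phase, so averaging over it replaces `exp (-iθ s)`
by `cos θ`. -/
theorem expect_mul_prod_exp_spin (T : Finset ι) {Φ : (ι → Fin 2) → ℂ}
    {θ : ι → (ι → Fin 2) → ℂ} (hΦ : DependsOn Φ (T : Set ι)ᶜ)
    (hθ : ∀ i ∈ T, DependsOn (θ i) (T : Set ι)ᶜ) :
    𝔼 z, Φ z * ∏ i ∈ T, Complex.exp (-Complex.I * (θ i z * spin (z i))) =
      𝔼 z, Φ z * ∏ i ∈ T, Complex.cos (θ i z) := by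
  induction T using Finset.induction_on generalizing Φ with
  | empty => simp
  | insert i T hi ih =>
    have hsub : ((insert i T : Finset ι) : Set ι)ᶜ ⊆ (T : Set ι)ᶜ := by simp
    have hsub_i : ((insert i T : Finset ι) : Set ι)ᶜ ⊆ {i}ᶜ := by simp
    have hΦ' : DependsOn (fun z => Φ z * Complex.exp (-Complex.I * (θ i z * spin (z i))))
        (T : Set ι)ᶜ := fun z w h => by
      simp only [hΦ.mono hsub h, (hθ i (by simp)).mono hsub h, h i hi]
    have hodd : 𝔼 z, (Complex.I * Φ z * (∏ j ∈ T, Complex.cos (θ j z)) *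
        Complex.sin (θ i z)) * spin (z i) = 0 := by
      refine expect_mul_spin_eq_zero fun z w h => ?_
      have hθ' : ∀ j ∈ insert i T, θ j z = θ j w := fun j hj => (hθ j hj).mono hsub_i h
      rw [hΦ.mono hsub_i h, hθ' i (by simp), Finset.prod_congr rfl fun j hj => by
        rw [hθ' j (Finset.mem_insert_of_mem hj)]]
    calc 𝔼 z, Φ z * ∏ j ∈ insert i T, Complex.exp (-Complex.I * (θ j z * spin (z j)))
        = 𝔼 z, Φ z * Complex.exp (-Complex.I * (θ i z * spin (z i))) *
            ∏ j ∈ T, Complex.exp (-Complex.I * (θ j z * spin (z j))) := by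
          simp only [Finset.prod_insert hi, mul_assoc]
      _ = 𝔼 z, Φ z * Complex.exp (-Complex.I * (θ i z * spin (z i))) *
            ∏ j ∈ T, Complex.cos (θ j z) :=
          ih hΦ' fun j hj => (hθ j (Finset.mem_insert_of_mem hj)).mono hsub
      _ = 𝔼 z, (Φ z * ∏ j ∈ insert i T, Complex.cos (θ j z) -
            (Complex.I * Φ z * (∏ j ∈ T, Complex.cos (θ j z)) * Complex.sin (θ i z)) *
              spin (z i)) := by
          refine Finset.expect_congr rfl fun z _ => ?_
          rw [exp_neg_I_mul_spin, Finset.prod_insert hi]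
          ring
      _ = 𝔼 z, Φ z * ∏ j ∈ insert i T, Complex.cos (θ j z) := by
          rw [Finset.expect_sub_distrib, hodd, sub_zero]

theorem expect_spin_mul_spin_mul_exp_cut_singleton (w : ι → ℂ) {u v : ι} (huv : u ≠ v) :
    𝔼 z : ι → Fin 2, spin (z u) * spin (z v) *
        Complex.exp (-Complex.I * ∑ i ∈ {u}ᶜ, w i * (spin (z u) * spin (z i))) =
      -Complex.I * Complex.sin (w v) * ∏ i ∈ {u, v}ᶜ, Complex.cos (w i) := by
  have hcompl : ({u} : Finset ι)ᶜ = insert v {u, v}ᶜ := by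
    rw [Finset.pair_comm, Finset.insert_compl_insert (by simpa using huv.symm)]
  calc 𝔼 z : ι → Fin 2, spin (z u) * spin (z v) *
        Complex.exp (-Complex.I * ∑ i ∈ {u}ᶜ, w i * (spin (z u) * spin (z i)))
      = 𝔼 z : ι → Fin 2, spin (z u) * spin (z v) *
          Complex.exp (-Complex.I * (w v * (spin (z u) * spin (z v)))) *
          ∏ i ∈ {u, v}ᶜ, Complex.exp (-Complex.I * (w i * spin (z u) * spin (z i))) := by
        simp only [hcompl, Finset.sum_insert (show v ∉ ({u, v} : Finset ι)ᶜ by simp), mul_add,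
          Complex.exp_add, Finset.mul_sum, Complex.exp_sum, mul_assoc]
    _ = 𝔼 z : ι → Fin 2, spin (z u) * spin (z v) *
          Complex.exp (-Complex.I * (w v * (spin (z u) * spin (z v)))) *
          ∏ i ∈ {u, v}ᶜ, Complex.cos (w i * spin (z u)) :=
        expect_mul_prod_exp_spin _ (fun z z' h => by simp [h u, h v])
          fun i _ z z' h => by simp [h u]
    _ = 𝔼 z : ι → Fin 2, (Complex.cos (w v) * (∏ i ∈ {u, v}ᶜ, Complex.cos (w i)) *
          (spin (z u) * spin (z v)) +
          -Complex.I * Complex.sin (w v) * ∏ i ∈ {u, v}ᶜ, Complex.cos (w i)) := by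
        refine Finset.expect_congr rfl fun z _ => ?_
        have hsq := spin_mul_self (z u + z v)
        simp only [cos_mul_spin, ← spin_add, exp_neg_I_mul_spin]
        linear_combination -(Complex.I * Complex.sin (w v) *
          ∏ i ∈ {u, v}ᶜ, Complex.cos (w i)) * hsq
    _ = -Complex.I * Complex.sin (w v) * ∏ i ∈ {u, v}ᶜ, Complex.cos (w i) := by
        rw [Finset.expect_add_distrib, ← Finset.mul_expect, expect_spin_mul_spin huv, mul_zero,
          zero_add, Fintype.expect_const]

theorem expect_spin_mul_spin_mul_exp_cut_pair (f g : ι → ℂ) {u v : ι} (huv : u ≠ v) :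
    𝔼 z : ι → Fin 2, spin (z u) * spin (z v) * Complex.exp (-Complex.I *
        ∑ i ∈ {u, v}ᶜ, (f i * (spin (z u) * spin (z i)) + g i * (spin (z v) * spin (z i)))) =
      (∏ i ∈ {u, v}ᶜ, Complex.cos (f i + g i) - ∏ i ∈ {u, v}ᶜ, Complex.cos (f i - g i)) / 2 := by
  set A := ∏ i ∈ {u, v}ᶜ, Complex.cos (f i + g i)
  set B := ∏ i ∈ {u, v}ᶜ, Complex.cos (f i - g i)
  calc 𝔼 z : ι → Fin 2, spin (z u) * spin (z v) * Complex.exp (-Complex.I *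
        ∑ i ∈ {u, v}ᶜ, (f i * (spin (z u) * spin (z i)) + g i * (spin (z v) * spin (z i))))
      = 𝔼 z : ι → Fin 2, spin (z u) * spin (z v) * ∏ i ∈ {u, v}ᶜ,
          Complex.exp (-Complex.I * ((f i * spin (z u) + g i * spin (z v)) * spin (z i))) := by
        simp only [Finset.mul_sum, Complex.exp_sum, add_mul, mul_assoc]
    _ = 𝔼 z : ι → Fin 2, spin (z u) * spin (z v) *
          ∏ i ∈ {u, v}ᶜ, Complex.cos (f i * spin (z u) + g i * spin (z v)) :=
        expect_mul_prod_exp_spin _ (fun z z' h => by simp [h u, h v])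
          fun i _ z z' h => by simp [h u, h v]
    _ = 𝔼 z : ι → Fin 2, ((A + B) / 2 * (spin (z u) * spin (z v)) + (A - B) / 2) := by
        refine Finset.expect_congr rfl fun z _ => ?_
        rw [prod_cos_mul_spin_add_mul_spin]
        linear_combination (A - B) / 2 * (spin (z v) * spin (z v) * spin_mul_self (z u) +
          spin_mul_self (z v))
    _ = (A - B) / 2 := by
        rw [Finset.expect_add_distrib, ← Finset.mul_expect, expect_spin_mul_spin huv, mul_zero,
          zero_add, Fintype.expect_const]

end SpinAverages

section Operators

variable {n : ℕ}

/-- The product of Pauli `X` over the qubits in `S`, encoded as a permutation matrix. -/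
def pauliX (S : Finset (Fin n)) : Operator n := (flipBits S).permMatrix ℂ

theorem onQubit_apply (A : Matrix (Fin 2) (Fin 2) ℂ) (u : Fin n) (z w : Fin n → Fin 2) :
    onQubit A u z w = if ∀ v, v ≠ u → z v = w v then A (z u) (w u) else 0 :=
  rfl

theorem sigmaX_eq_pauliX (u : Fin n) : sigmaX u = pauliX {u} := by
  ext z w
  have hX : ∀ a b : Fin 2, !![0, 1; 1, 0] a b = if a + 1 = b then (1 : ℂ) else 0 := by
    intro a b; fin_cases a <;> fin_cases b <;> simp
  have hflip : flipBits {u} z = w ↔ (∀ v, v ≠ u → z v = w v) ∧ z u + 1 = w u := by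
    refine ⟨?_, fun ⟨hv, hu⟩ => funext fun v => ?_⟩
    · rintro rfl
      exact ⟨fun v hv => by simp [flipBits_apply, hv], by simp [flipBits_apply]⟩
    · by_cases hvu : v = u
      · simpa [flipBits_apply, hvu] using hu
      · simpa [flipBits_apply, hvu] using hv v hvu
  simp [sigmaX, onQubit_apply, hX, pauliX, PEquiv.toMatrix_apply, Equiv.toPEquiv_apply, hflip,
    ite_and]

theorem sigmaZ_eq_diagonal (u : Fin n) : sigmaZ u = Matrix.diagonal fun z => spin (z u) := by
  ext z w
  have hZ : ∀ a b : Fin 2, !![1, 0; 0, -1] a b = if a = b then spin a else 0 := by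
    intro a b; fin_cases a <;> fin_cases b <;> simp
  have heq : z = w ↔ (∀ v, v ≠ u → z v = w v) ∧ z u = w u := by
    rw [funext_iff]
    grind
  simp [sigmaZ, onQubit_apply, hZ, Matrix.diagonal_apply, heq, ite_and]

theorem sigmaZ_mul_sigmaZ (u v : Fin n) :
    sigmaZ u * sigmaZ v = Matrix.diagonal fun z => spin (z u) * spin (z v) := by
  simp [sigmaZ_eq_diagonal]

theorem sigmaZ_mul_self (u : Fin n) : sigmaZ u * sigmaZ u = 1 := by
  simp [sigmaZ_mul_sigmaZ, spin_mul_self]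

theorem pauliX_empty : pauliX (∅ : Finset (Fin n)) = 1 := by
  simp [pauliX, flipBits_empty]

theorem pauliX_conjTranspose (S : Finset (Fin n)) : (pauliX S)ᴴ = pauliX S := by
  rw [pauliX, Matrix.conjTranspose_permMatrix, Equiv.Perm.inv_def, flipBits_symm]

theorem pauliX_mul_pauliX (S R : Finset (Fin n)) :
    pauliX S * pauliX R = pauliX (symmDiff S R) := by
  rw [pauliX, pauliX, ← Matrix.permMatrix_mul, flipBits_mul_flipBits, symmDiff_comm, pauliX]

theorem pauliX_commute (S R : Finset (Fin n)) : Commute (pauliX S) (pauliX R) := by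
  rw [Commute, SemiconjBy, pauliX_mul_pauliX, pauliX_mul_pauliX, symmDiff_comm]

theorem pauliX_mul_self (S : Finset (Fin n)) : pauliX S * pauliX S = 1 := by
  rw [pauliX_mul_pauliX, symmDiff_self, Finset.bot_eq_empty, pauliX_empty]

theorem pauliX_mul (S : Finset (Fin n)) (A : Operator n) :
    pauliX S * A = A.submatrix (flipBits S) id :=
  PEquiv.toMatrix_toPEquiv_mul _ _

theorem mul_pauliX (A : Operator n) (S : Finset (Fin n)) :
    A * pauliX S = A.submatrix id (flipBits S) := by
  rw [pauliX, PEquiv.mul_toMatrix_toPEquiv, flipBits_symm]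

/-- The correlation `Tr(X_S Z_u Z_v σ)`, where `X_S` is the product of Pauli `X` over `S`. -/
def flipCorrelation (σ : Operator n) (u v : Fin n) (S : Finset (Fin n)) : ℂ :=
  (pauliX S * (sigmaZ u * sigmaZ v * σ)).trace

theorem flipCorrelation_eq_sum (σ : Operator n) (u v : Fin n) (S : Finset (Fin n)) :
    flipCorrelation σ u v S = ∑ z, spin (z u) * spin (z v) * σ z (flipBits S z) := by
  rw [flipCorrelation, Matrix.trace_mul_comm, mul_pauliX, sigmaZ_mul_sigmaZ]
  simp [Matrix.trace]

theorem sigmaZ_mul_pauliX (u : Fin n) (S : Finset (Fin n)) :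
    sigmaZ u * pauliX S = (if u ∈ S then -1 else 1 : ℂ) • (pauliX S * sigmaZ u) := by
  ext z w
  rw [pauliX_mul, mul_pauliX, sigmaZ_eq_diagonal]
  by_cases hzw : z = flipBits S w
  · simp [hzw, spin_flipBits, flipBits_flipBits, flipBits_empty]
  · have hzw' : flipBits S z ≠ w := fun h => hzw <| by
      simp [← h, flipBits_flipBits, flipBits_empty]
    simp [hzw, hzw']

end Operators

theorem exp_smul_of_mul_self_eq_one {A : Type*} [Ring A] [Algebra ℂ A] [TopologicalSpace A]
    [IsTopologicalRing A] [T2Space A] [ContinuousSMul ℂ A] {x : A} (hx : x * x = 1) (a : ℂ) :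
    NormedSpace.exp (a • x) = Complex.cosh a • (1 : A) + Complex.sinh a • x := by
  have heven (k : ℕ) : x ^ (2 * k) = 1 := by rw [pow_mul, pow_two, hx, one_pow]
  have hodd (k : ℕ) : x ^ (2 * k + 1) = x := by rw [pow_succ, heven, one_mul]
  rw [NormedSpace.exp_eq_tsum ℂ]
  refine (HasSum.even_add_odd ?_ ?_).tsum_eq
  · simpa [smul_pow, heven, smul_smul, div_eq_inv_mul]
      using (Complex.hasSum_cosh a).smul_const (1 : A)
  · simpa [smul_pow, hodd, smul_smul, div_eq_inv_mul] using (Complex.hasSum_sinh a).smul_const x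

section Mixer

variable {n : ℕ}

theorem mixer_conjTranspose (β : ℝ) : (mixer n β)ᴴ = mixer n (-β) := by
  simp only [mixer, ← Matrix.exp_conjTranspose, sigmaX_eq_pauliX, Matrix.conjTranspose_smul,
    Matrix.conjTranspose_sum, pauliX_conjTranspose]
  simp

theorem mixer_mul_mixer (α β : ℝ) : mixer n α * mixer n β = mixer n (α + β) := by
  rw [mixer, mixer, ← Matrix.exp_add_of_commute _ _ (((Commute.refl _).smul_left _).smul_right _),
    ← add_smul, mixer]
  push_cast
  ring_nf

theorem mixer_zero : mixer n 0 = 1 := by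
  simp [mixer]

theorem mixer_mul_conjTranspose (β : ℝ) : mixer n β * (mixer n β)ᴴ = 1 := by
  rw [mixer_conjTranspose, mixer_mul_mixer, add_neg_cancel, mixer_zero]

theorem mixer_conjTranspose_mul (β : ℝ) : (mixer n β)ᴴ * mixer n β = 1 := by
  rw [mixer_conjTranspose, mixer_mul_mixer, neg_add_cancel, mixer_zero]

theorem sigmaZ_mul_sum_sigmaX_mul_sigmaZ (u : Fin n) :
    sigmaZ u * (∑ v, sigmaX v) * sigmaZ u = (∑ v, sigmaX v) - (2 : ℂ) • sigmaX u := by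
  have hv (v : Fin n) : sigmaZ u * sigmaX v * sigmaZ u =
      sigmaX v - if u = v then (2 : ℂ) • sigmaX v else 0 := by
    rw [sigmaX_eq_pauliX, sigmaZ_mul_pauliX, smul_mul_assoc, mul_assoc, sigmaZ_mul_self, mul_one]
    by_cases h : u = v
    · simp only [h, Finset.mem_singleton, if_true]
      module
    · simp [h]
  simp only [Finset.mul_sum, Finset.sum_mul, hv, Finset.sum_sub_distrib, Finset.sum_ite_eq,
    Finset.mem_univ, if_true]

theorem sigmaZ_mul_mixer (β : ℝ) (u : Fin n) :
    sigmaZ u * mixer n β =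
      mixer n β * (Complex.cos (2 * β) • 1 + (Complex.I * Complex.sin (2 * β)) • sigmaX u) *
        sigmaZ u := by
  set B : Operator n := -(Complex.I * β) • ∑ v, sigmaX v with hB
  have hZinv : (sigmaZ u : Operator n)⁻¹ = sigmaZ u := Matrix.inv_eq_right_inv (sigmaZ_mul_self u)
  have hconj : sigmaZ u * B * sigmaZ u = B + (2 * β * Complex.I) • sigmaX u := by
    rw [hB, mul_smul_comm, smul_mul_assoc, sigmaZ_mul_sum_sigmaX_mul_sigmaZ]
    module
  have hcomm : Commute B ((2 * β * Complex.I) • sigmaX u) := by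
    simp only [hB, sigmaX_eq_pauliX]
    exact ((Commute.sum_left _ _ _ fun v _ => pauliX_commute _ _).smul_left _).smul_right _
  have hX : (sigmaX u : Operator n) * sigmaX u = 1 := by rw [sigmaX_eq_pauliX, pauliX_mul_self]
  have hmixer : sigmaZ u * mixer n β * sigmaZ u =
      mixer n β * NormedSpace.exp ((2 * β * Complex.I) • sigmaX u) := by
    have hexp := Matrix.exp_conj (sigmaZ u) B (.of_mul_eq_one _ (sigmaZ_mul_self u))
    rw [hZinv, hconj, Matrix.exp_add_of_commute _ _ hcomm] at hexp
    exact hexp.symm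
  rw [exp_smul_of_mul_self_eq_one hX, Complex.cosh_mul_I, Complex.sinh_mul_I,
    mul_comm _ Complex.I] at hmixer
  rw [← hmixer, mul_assoc _ (sigmaZ u) (sigmaZ u), sigmaZ_mul_self, mul_one]

theorem mixer_conj_sigmaZ (β : ℝ) (u : Fin n) :
    (mixer n β)ᴴ * sigmaZ u * mixer n β =
      (Complex.cos (2 * β) • 1 + (Complex.I * Complex.sin (2 * β)) • sigmaX u) * sigmaZ u := by
  rw [mul_assoc, sigmaZ_mul_mixer, ← mul_assoc, ← mul_assoc, mixer_conjTranspose_mul, one_mul]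

theorem mixer_conj_sigmaZ_mul_sigmaZ (β : ℝ) {u v : Fin n} (huv : u ≠ v) :
    (mixer n β)ᴴ * (sigmaZ u * sigmaZ v) * mixer n β =
      (Complex.cos (2 * β) ^ 2 • pauliX ∅ +
        (Complex.I * Complex.sin (2 * β) * Complex.cos (2 * β)) • (pauliX {u} + pauliX {v}) -
        Complex.sin (2 * β) ^ 2 • pauliX {u, v}) * (sigmaZ u * sigmaZ v) := by
  have hinsert : (mixer n β)ᴴ * (sigmaZ u * sigmaZ v) * mixer n β =
      ((mixer n β)ᴴ * sigmaZ u * mixer n β) * ((mixer n β)ᴴ * sigmaZ v * mixer n β) := by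
    calc (mixer n β)ᴴ * (sigmaZ u * sigmaZ v) * mixer n β
        = (mixer n β)ᴴ * sigmaZ u * (mixer n β * (mixer n β)ᴴ) * sigmaZ v * mixer n β := by
          rw [mixer_mul_conjTranspose]; noncomm_ring
      _ = _ := by noncomm_ring
  have hZX : sigmaZ u * (pauliX {v} * sigmaZ v) = pauliX {v} * (sigmaZ u * sigmaZ v) := by
    rw [← mul_assoc, sigmaZ_mul_pauliX, if_neg (by simpa using huv), one_smul, mul_assoc]
  have hXX : pauliX {u} * (pauliX {v} * (sigmaZ u * sigmaZ v)) =
      pauliX {u, v} * (sigmaZ u * sigmaZ v) := by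
    rw [← mul_assoc, pauliX_mul_pauliX, (Finset.disjoint_singleton.mpr huv).symmDiff_eq_sup]
    rfl
  rw [hinsert, mixer_conj_sigmaZ, mixer_conj_sigmaZ, sigmaX_eq_pauliX, sigmaX_eq_pauliX,
    pauliX_empty]
  generalize Complex.cos (2 * β) = k
  generalize Complex.sin (2 * β) = s
  have hI : Complex.I * s * (Complex.I * s) = -s ^ 2 := by linear_combination s ^ 2 * Complex.I_sq
  simp only [add_mul, sub_mul, mul_add, smul_mul_assoc, mul_smul_comm, one_mul, mul_assoc, hZX,
    hXX, smul_add, smul_smul, hI]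
  module

theorem expectation_sigmaZ_mul_sigmaZ_mixer_conj (β : ℝ) {u v : Fin n} (huv : u ≠ v)
    (σ : Operator n) :
    expectation (sigmaZ u * sigmaZ v) (mixer n β * σ * (mixer n β)ᴴ) =
      Complex.cos (2 * β) ^ 2 * flipCorrelation σ u v ∅ +
        Complex.I * Complex.sin (2 * β) * Complex.cos (2 * β) *
          (flipCorrelation σ u v {u} + flipCorrelation σ u v {v}) -
        Complex.sin (2 * β) ^ 2 * flipCorrelation σ u v {u, v} := by
  have hcycle : expectation (sigmaZ u * sigmaZ v) (mixer n β * σ * (mixer n β)ᴴ) =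
      ((mixer n β)ᴴ * (sigmaZ u * sigmaZ v) * mixer n β * σ).trace := by
    rw [expectation, ← mul_assoc, Matrix.trace_mul_comm]
    simp only [mul_assoc]
  rw [hcycle, mixer_conj_sigmaZ_mul_sigmaZ β huv]
  simp only [flipCorrelation, sub_mul, add_mul, smul_mul_assoc, Matrix.trace_sub, Matrix.trace_add,
    Matrix.trace_smul, mul_assoc, smul_eq_mul]

end Mixer

section Energy

variable {n : ℕ}

/-- The eigenvalue of `couplingOp c` on the basis state `|z⟩`. -/
def energy (c : Sym2 (Fin n) → ℝ) (z : Fin n → Fin 2) : ℂ :=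
  ∑ u, ∑ v ∈ Finset.Ioi u, c s(u, v) * (spin (z u) * spin (z v))

theorem couplingOp_eq_diagonal (c : Sym2 (Fin n) → ℝ) :
    couplingOp c = Matrix.diagonal (energy c) := by
  ext z w
  by_cases h : z = w <;>
    simp [couplingOp, energy, sigmaZ_mul_sigmaZ, Matrix.sum_apply, h]

theorem nativeH_eq_diagonal (n : ℕ) :
    nativeH n = Matrix.diagonal ((n : ℂ)⁻¹ • energy fun _ => 1) := by
  have hising : isingOp n = couplingOp fun _ => 1 := by simp [isingOp, couplingOp]
  rw [nativeH, hising, couplingOp_eq_diagonal, Matrix.diagonal_smul]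

theorem flippedIsingOp_eq_diagonal (S : Finset (Fin n)) :
    flippedIsingOp S = Matrix.diagonal (energy (fun _ => 1) ∘ flipBits S) := by
  have hsign (u v : Fin n) (z : Fin n → Fin 2) :
      (-1 : ℂ) ^ ((if u ∈ S then 1 else 0) + (if v ∈ S then 1 else 0)) *
        (spin (z u) * spin (z v)) = spin (flipBits S z u) * spin (flipBits S z v) := by
    rw [spin_flipBits, spin_flipBits]
    split_ifs <;> simp
  ext z w
  by_cases h : z = w
  · simp [flippedIsingOp, energy, sigmaZ_mul_sigmaZ, Matrix.sum_apply, h, hsign]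
  · simp [flippedIsingOp, sigmaZ_mul_sigmaZ, Matrix.sum_apply, h]

theorem energy_sub_energy_flipBits (c : Sym2 (Fin n) → ℝ) (S : Finset (Fin n))
    (z : Fin n → Fin 2) :
    energy c z - energy c (flipBits S z) =
      ∑ u ∈ S, ∑ v ∈ Sᶜ, 2 * c s(v, u) * (spin (z u) * spin (z v)) := by
  let cut (u v : Fin n) : ℂ :=
    if u ∈ S then if v ∈ Sᶜ then 2 * c s(v, u) * (spin (z u) * spin (z v)) else 0 else 0
  calc energy c z - energy c (flipBits S z)
      = ∑ u, ∑ v ∈ Finset.Ioi u, (cut u v + cut v u) := by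
        simp only [energy, ← Finset.sum_sub_distrib, spin_flipBits, cut, Finset.mem_compl]
        refine Finset.sum_congr rfl fun u _ => Finset.sum_congr rfl fun v _ => ?_
        rw [Sym2.eq_swap (a := u)]
        by_cases hu : u ∈ S <;> by_cases hv : v ∈ S <;> simp [hu, hv] <;> ring
    _ = ∑ u, ∑ v ∈ {u}ᶜ, cut u v :=
        Finset.sum_sum_Ioi_add_eq_sum_sum_off_diag fun v u => cut u v
    _ = ∑ u, ∑ v, cut u v := by
        refine Finset.sum_congr rfl fun u _ => Finset.sum_subset (Finset.subset_univ _) ?_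
        intro v _ hv
        obtain rfl : v = u := by simpa using hv
        by_cases hu : v ∈ S <;> simp [cut, hu]
    _ = ∑ u ∈ S, ∑ v ∈ Sᶜ, 2 * c s(v, u) * (spin (z u) * spin (z v)) := by
        simp only [cut, Finset.sum_ite_irrel, Finset.sum_const_zero, Finset.sum_ite_mem,
          Finset.univ_inter]

end Energy

section MasterEquation

theorem eq_exp_smul_mul_of_hasDerivWithinAt {A : Type*} [NormedRing A] [NormedAlgebra ℝ A]
    [CompleteSpace A] {f : ℝ → A} {a : A} {T : ℝ} (hT : 0 ≤ T)
    (hf : ∀ t ∈ Set.Icc 0 T, HasDerivWithinAt f (a * f t) (Set.Icc 0 T) t) :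
    f T = NormedSpace.exp (T • a) * f 0 := by
  have hexp (t : ℝ) : HasDerivAt (fun t : ℝ => NormedSpace.exp (t • a) * f 0)
      (a * (NormedSpace.exp (t • a) * f 0)) t := by
    simpa [mul_assoc] using (hasDerivAt_exp_smul_const' a t).mul_const (f 0)
  refine ODE_solution_unique (v := fun _ x => a * x) (K := ‖a‖₊)
    (fun _ => LipschitzWith.of_dist_le_mul fun x y => ?_)
    (fun t ht => (hf t ht).continuousWithinAt)
    (fun t ht => (hf t (Set.Ico_subset_Icc_self ht)).mono_of_mem_nhdsWithin
      (Icc_mem_nhdsGE_of_mem ht))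
    (fun t _ => (hexp t).continuousAt.continuousWithinAt)
    (fun t _ => (hexp t).hasDerivWithinAt) (by simp) (Set.right_mem_Icc.mpr hT)
  simpa [dist_eq_norm, ← mul_sub] using norm_mul_le a (x - y)

variable {n : ℕ}

/-- Dephasing with rate `Γ` for time `t` under diagonal Hamiltonians whose time integral is
`diagonal φ`: the entry `⟨z|ρ|w⟩` acquires the phase `φ z - φ w` and is damped by `exp (-Γt/2)` for
each qubit on which `z` and `w` differ. -/
def dephase (Γ : ℝ) (φ : (Fin n → Fin 2) → ℂ) (t : ℝ) (ρ : Operator n) : Operator n :=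
  Matrix.of fun z w =>
    Complex.exp (-(Complex.I * (φ z - φ w) + Γ * t / 2 * hammingDist z w)) * ρ z w

theorem dephase_apply (Γ : ℝ) (φ : (Fin n → Fin 2) → ℂ) (t : ℝ) (ρ : Operator n)
    (z w : Fin n → Fin 2) :
    dephase Γ φ t ρ z w =
      Complex.exp (-(Complex.I * (φ z - φ w) + Γ * t / 2 * hammingDist z w)) * ρ z w :=
  rfl

theorem dephase_zero (Γ : ℝ) (ρ : Operator n) : dephase Γ 0 0 ρ = ρ := by
  ext z w
  simp [dephase_apply]

theorem dephase_dephase (Γ : ℝ) (φ ψ : (Fin n → Fin 2) → ℂ) (s t : ℝ) (ρ : Operator n) :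
    dephase Γ φ s (dephase Γ ψ t ρ) = dephase Γ (ψ + φ) (t + s) ρ := by
  ext z w
  simp only [dephase_apply, ← mul_assoc, ← Complex.exp_add, Pi.add_apply]
  push_cast
  ring_nf

theorem dephase_submatrix_flipBits (Γ : ℝ) (φ : (Fin n → Fin 2) → ℂ) (t : ℝ) (ρ : Operator n)
    (S : Finset (Fin n)) :
    dephase Γ φ t (ρ.submatrix (flipBits S) (flipBits S)) =
      (dephase Γ (φ ∘ flipBits S) t ρ).submatrix (flipBits S) (flipBits S) := by
  ext z w
  simp [dephase_apply, hammingDist_flipBits_flipBits, flipBits_flipBits, flipBits_empty]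

theorem jump_eq_diagonal (Γ : ℝ) (u : Fin n) :
    jump Γ u = Matrix.diagonal fun z => (√(Γ / 8) : ℂ) * spin (z u) := by
  rw [jump, sigmaZ_eq_diagonal, ← Matrix.diagonal_smul]
  rfl

theorem jump_conjTranspose (Γ : ℝ) (u : Fin n) : (jump Γ u)ᴴ = jump Γ u := by
  have hstar (b : Fin 2) : star (spin b) = spin b := by fin_cases b <;> simp
  simp [jump_eq_diagonal, Matrix.diagonal_conjTranspose, Pi.star_def, hstar]

theorem lindbladian_diagonal_apply {Γ : ℝ} (hΓ : 0 ≤ Γ) (h : (Fin n → Fin 2) → ℂ)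
    (ρ : Operator n) (z w : Fin n → Fin 2) :
    lindbladian Γ (Matrix.diagonal h) ρ z w =
      -(Complex.I * (h z - h w) + Γ / 2 * hammingDist z w) * ρ z w := by
  have hsqrt : (√(Γ / 8) : ℂ) * √(Γ / 8) = Γ / 8 := by
    exact_mod_cast Real.mul_self_sqrt (div_nonneg hΓ (by norm_num : (0 : ℝ) ≤ 8))
  have hnoise (u : Fin n) :
      (jump Γ u * (jump Γ u)ᴴ * ρ - (2 : ℂ) • (jump Γ u * ρ * (jump Γ u)ᴴ)
        + ρ * (jump Γ u * (jump Γ u)ᴴ)) z w =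
      Γ / 4 * ρ z w * (1 - spin (z u) * spin (w u)) := by
    rw [jump_conjTranspose, jump_eq_diagonal]
    simp only [Matrix.add_apply, Matrix.sub_apply,
      Matrix.smul_apply, Matrix.diagonal_mul_diagonal, Matrix.diagonal_mul, Matrix.mul_diagonal,
      mul_mul_mul_comm _ (spin _) _ (spin _), hsqrt, spin_mul_self, smul_eq_mul]
    linear_combination -2 * ρ z w * spin (z u) * spin (w u) * hsqrt
  simp only [lindbladian, Matrix.sub_apply, Matrix.neg_apply, Matrix.smul_apply, Matrix.sum_apply,
    hnoise, Matrix.diagonal_mul, Matrix.mul_diagonal, smul_eq_mul, ← Finset.mul_sum,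
    sum_one_sub_spin_mul_spin]
  ring

theorem dephase_smul_apply (Γ : ℝ) (h : (Fin n → Fin 2) → ℂ) (t : ℝ) (ρ : Operator n)
    (z w : Fin n → Fin 2) :
    dephase Γ ((t : ℂ) • h) t ρ z w =
      NormedSpace.exp (t • -(Complex.I * (h z - h w) + Γ / 2 * hammingDist z w)) * ρ z w := by
  rw [dephase_apply, Complex.exp_eq_exp_ℂ, Complex.real_smul]
  simp only [Pi.smul_apply, smul_eq_mul]
  ring_nf

theorem solvesMasterEquation_dephase {Γ : ℝ} (hΓ : 0 ≤ Γ) (h : (Fin n → Fin 2) → ℂ) (T : ℝ)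
    (ρ : Operator n) :
    SolvesMasterEquation Γ (Matrix.diagonal h) T fun t => dephase Γ ((t : ℂ) • h) t ρ := by
  intro t _ z w
  simp only [lindbladian_diagonal_apply hΓ, dephase_smul_apply, ← mul_assoc]
  exact ((hasDerivAt_exp_smul_const' _ t).mul_const _).hasDerivWithinAt

theorem SolvesMasterEquation.eq_dephase {Γ : ℝ} (hΓ : 0 ≤ Γ) {h : (Fin n → Fin 2) → ℂ} {T : ℝ}
    (hT : 0 ≤ T) {r : ℝ → Operator n} (hr : SolvesMasterEquation Γ (Matrix.diagonal h) T r) :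
    r T = dephase Γ ((T : ℂ) • h) T (r 0) := by
  ext z w
  rw [dephase_smul_apply]
  refine eq_exp_smul_mul_of_hasDerivWithinAt (f := fun t => r t z w) hT fun t ht => ?_
  rw [← lindbladian_diagonal_apply hΓ]
  exact hr t ht z w

end MasterEquation

section Execution

variable {n : ℕ}

theorem executes_pulse_iff {Γ : ℝ} (hΓ : 0 ≤ Γ) (s : ℤˣ) (τ : ℝ≥0) (P : Program n)
    (ρ ρ' : Operator n) :
    Executes Γ (Op.pulse s τ :: P) ρ ρ' ↔
      Executes Γ P (dephase Γ (((s : ℤ) * (τ : ℝ) * (n : ℂ)⁻¹) • energy fun _ => 1) τ ρ) ρ' := by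
  have hH : ((s : ℤ) : ℂ) • nativeH n =
      Matrix.diagonal ((((s : ℤ) : ℂ) * (n : ℂ)⁻¹) • energy fun _ => 1) := by
    rw [nativeH_eq_diagonal, ← Matrix.diagonal_smul, smul_smul]
  have hφ : (((s : ℤ) * (τ : ℝ) * (n : ℂ)⁻¹) • energy fun _ : Sym2 (Fin n) => (1 : ℝ)) =
      ((τ : ℝ) : ℂ) • (((s : ℤ) : ℂ) * (n : ℂ)⁻¹) • energy fun _ => 1 := by
    rw [smul_smul]
    ring_nf
  rw [Executes, hH, hφ]
  constructor
  · rintro ⟨r, hr, rfl, hP⟩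
    rwa [hr.eq_dephase hΓ τ.coe_nonneg] at hP
  · intro hP
    exact ⟨_, solvesMasterEquation_dephase hΓ _ _ ρ, by simp [dephase_zero], hP⟩

theorem sigmaX_mul_submatrix_flipBits_mul (u : Fin n) (S : Finset (Fin n)) (ρ : Operator n) :
    sigmaX u * ρ.submatrix (flipBits S) (flipBits S) * (sigmaX u)ᴴ =
      ρ.submatrix (flipBits (symmDiff S {u})) (flipBits (symmDiff S {u})) := by
  ext z w
  simp [sigmaX_eq_pauliX, pauliX_conjTranspose, pauliX_mul, mul_pauliX, flipBits_flipBits]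

theorem executes_submatrix_flipBits_iff {Γ : ℝ} (hΓ : 0 ≤ Γ) (P : Program n)
    (S : Finset (Fin n)) (ρ ρ' : Operator n) :
    Executes Γ P (ρ.submatrix (flipBits S) (flipBits S)) ρ' ↔
      ρ' = (dephase Γ (accumulated S P).diag (totalTime P) ρ).submatrix
        (flipBits (netFlips S P)) (flipBits (netFlips S P)) := by
  induction P generalizing S ρ with
  | nil => simp [Executes, netFlips, accumulated, totalTime, dephase_zero]
  | cons op P ih =>
    cases op with
    | flip u => simp only [Executes, sigmaX_mul_submatrix_flipBits_mul, ih, netFlips, accumulated,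
        totalTime]
    | pulse s τ =>
      rw [executes_pulse_iff hΓ, dephase_submatrix_flipBits, ih, dephase_dephase]
      simp [netFlips, accumulated, totalTime, flippedIsingOp_eq_diagonal, Pi.smul_comp]

theorem netFlips_scale (γ : ℝ≥0) (P : Program n) (S : Finset (Fin n)) :
    netFlips S (scale γ P) = netFlips S P := by
  induction P generalizing S with
  | nil => rfl
  | cons op P ih => cases op <;> exact ih _

theorem accumulated_scale (γ : ℝ≥0) (P : Program n) (S : Finset (Fin n)) :
    accumulated S (scale γ P) = ((γ : ℝ) : ℂ) • accumulated S P := by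
  induction P generalizing S with
  | nil => simp [scale, accumulated]
  | cons op P ih =>
    cases op with
    | flip u => exact ih _
    | pulse s τ =>
      rw [scale, accumulated, accumulated, ih, smul_add, smul_smul]
      push_cast
      ring_nf

theorem totalTime_scale (γ : ℝ≥0) (P : Program n) : totalTime (scale γ P) = γ * totalTime P := by
  induction P with
  | nil => simp [scale, totalTime]
  | cons op P ih => cases op <;> simp [scale, totalTime, ih, mul_add]

/-- The state of noisy QAOA just before the mixer is applied. -/
def dephasedState (Γ γ t : ℝ) (c : Sym2 (Fin n) → ℝ) : Operator n :=
  dephase Γ ((γ : ℂ) • energy c) t (plusState n)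

theorem isQAOAOutput_iff {Γ : ℝ} (hΓ : 0 ≤ Γ) (γ : ℝ≥0) (β : ℝ) {P : Program n}
    {c : Sym2 (Fin n) → ℝ} (hP : Compiles P c) (ρ : Operator n) :
    IsQAOAOutput Γ P γ β ρ ↔
      ρ = mixer n β * dephasedState Γ γ (γ * totalTime P) c * (mixer n β)ᴴ := by
  obtain ⟨hflips, hacc⟩ := hP
  have hexec (σ : Operator n) : Executes Γ (scale γ P) (plusState n) σ ↔
      σ = dephasedState Γ γ (γ * totalTime P) c := by
    simpa [netFlips_scale, accumulated_scale, totalTime_scale, hflips, hacc, flipBits_empty,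
      couplingOp_eq_diagonal, dephasedState]
      using executes_submatrix_flipBits_iff hΓ (scale γ P) ∅ (plusState n) σ
  simp [IsQAOAOutput, hexec]

end Execution

section Correlations

variable {n : ℕ}

theorem plusState_apply (z w : Fin n → Fin 2) :
    plusState n z w = (Fintype.card (Fin n → Fin 2) : ℂ)⁻¹ := by
  have hsqrt : (√2 : ℂ) * √2 = 2 := by
    rw [← Complex.ofReal_mul, Real.mul_self_sqrt zero_le_two, Complex.ofReal_ofNat]
  simp [plusState, plusVec, Matrix.vecMulVec_apply, ← mul_inv, ← mul_pow, hsqrt]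

theorem flipCorrelation_comm (σ : Operator n) (u v : Fin n) (S : Finset (Fin n)) :
    flipCorrelation σ u v S = flipCorrelation σ v u S := by
  simp only [flipCorrelation_eq_sum]
  exact Finset.sum_congr rfl fun z _ => by rw [mul_comm (spin (z u))]

theorem flipCorrelation_dephasedState (Γ γ t : ℝ) (c : Sym2 (Fin n) → ℝ) (u v : Fin n)
    (S : Finset (Fin n)) :
    flipCorrelation (dephasedState Γ γ t c) u v S =
      Complex.exp (-(Γ * t / 2 * S.card)) * 𝔼 z : Fin n → Fin 2, spin (z u) * spin (z v) *
        Complex.exp (-Complex.I *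
          ∑ x ∈ S, ∑ y ∈ Sᶜ, 2 * γ * c s(y, x) * (spin (z x) * spin (z y))) := by
  rw [flipCorrelation_eq_sum, Fintype.expect_eq_sum_div_card, ← mul_div_assoc, Finset.mul_sum,
    Finset.sum_div]
  refine Finset.sum_congr rfl fun z _ => ?_
  have hphase : ((γ : ℂ) • energy c) z - ((γ : ℂ) • energy c) (flipBits S z) =
      ∑ x ∈ S, ∑ y ∈ Sᶜ, 2 * γ * c s(y, x) * (spin (z x) * spin (z y)) := by
    rw [Pi.smul_apply, Pi.smul_apply, ← smul_sub, energy_sub_energy_flipBits, smul_eq_mul]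
    simp only [Finset.mul_sum, mul_assoc, mul_left_comm (γ : ℂ)]
  rw [dephasedState, dephase_apply, hphase, hammingDist_flipBits, plusState_apply, neg_add,
    ← neg_mul, Complex.exp_add]
  ring

theorem flipCorrelation_dephasedState_empty (Γ γ t : ℝ) (c : Sym2 (Fin n) → ℝ) {u v : Fin n}
    (huv : u ≠ v) : flipCorrelation (dephasedState Γ γ t c) u v ∅ = 0 := by
  simp [flipCorrelation_dephasedState, expect_spin_mul_spin huv]

theorem flipCorrelation_dephasedState_singleton (Γ γ t : ℝ) (c : Sym2 (Fin n) → ℝ) {u v : Fin n}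
    (huv : u ≠ v) :
    flipCorrelation (dephasedState Γ γ t c) u v {u} =
      -Complex.I * Complex.exp (-Γ * t / 2) * Complex.sin (2 * γ * c s(u, v)) *
        ∏ i ∈ {u, v}ᶜ, Complex.cos (2 * γ * c s(i, u)) := by
  simp only [flipCorrelation_dephasedState, Finset.sum_singleton, Finset.card_singleton]
  rw [expect_spin_mul_spin_mul_exp_cut_singleton (fun i => 2 * γ * c s(i, u)) huv,
    Sym2.eq_swap (a := v)]
  push_cast
  ring_nf

theorem flipCorrelation_dephasedState_pair (Γ γ t : ℝ) (c : Sym2 (Fin n) → ℝ) {u v : Fin n}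
    (huv : u ≠ v) :
    flipCorrelation (dephasedState Γ γ t c) u v {u, v} =
      Complex.exp (-Γ * t) / 2 *
        (∏ i ∈ {u, v}ᶜ, Complex.cos (2 * γ * (c s(i, u) + c s(i, v))) -
          ∏ i ∈ {u, v}ᶜ, Complex.cos (2 * γ * (c s(i, u) - c s(i, v)))) := by
  simp only [flipCorrelation_dephasedState, Finset.sum_pair huv, Finset.card_pair huv,
    ← Finset.sum_add_distrib]
  rw [expect_spin_mul_spin_mul_exp_cut_pair (fun i => 2 * γ * c s(i, u))
    (fun i => 2 * γ * c s(i, v)) huv]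
  simp only [← mul_add, ← mul_sub]
  push_cast
  ring_nf

theorem expectation_sigmaZ_mul_sigmaZ_mixer_conj_dephasedState (Γ γ t β : ℝ)
    (c : Sym2 (Fin n) → ℝ) {u v : Fin n} (huv : u ≠ v) :
    expectation (sigmaZ u * sigmaZ v) (mixer n β * dephasedState Γ γ t c * (mixer n β)ᴴ) =
      Complex.sin (4 * β) * Complex.sin (2 * γ * c s(u, v)) * Complex.exp (-Γ * t / 2) / 2 *
          (∏ i ∈ {u, v}ᶜ, Complex.cos (2 * γ * c s(i, v)) +
            ∏ i ∈ {u, v}ᶜ, Complex.cos (2 * γ * c s(i, u))) -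
        Complex.sin (2 * β) ^ 2 * Complex.exp (-Γ * t) / 2 *
          (∏ i ∈ {u, v}ᶜ, Complex.cos (2 * γ * (c s(i, u) + c s(i, v))) -
            ∏ i ∈ {u, v}ᶜ, Complex.cos (2 * γ * (c s(i, u) - c s(i, v)))) := by
  have hsin : Complex.sin (4 * β) = 2 * Complex.sin (2 * β) * Complex.cos (2 * β) := by
    rw [← Complex.sin_two_mul]
    ring_nf
  have hv : flipCorrelation (dephasedState Γ γ t c) u v {v} =
      -Complex.I * Complex.exp (-Γ * t / 2) * Complex.sin (2 * γ * c s(u, v)) *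
        ∏ i ∈ {u, v}ᶜ, Complex.cos (2 * γ * c s(i, v)) := by
    rw [flipCorrelation_comm, flipCorrelation_dephasedState_singleton _ _ _ _ huv.symm,
      Finset.pair_comm, Sym2.eq_swap]
  rw [expectation_sigmaZ_mul_sigmaZ_mixer_conj β huv,
    flipCorrelation_dephasedState_empty _ _ _ _ huv,
    flipCorrelation_dephasedState_singleton _ _ _ _ huv, hv,
    flipCorrelation_dephasedState_pair _ _ _ _ huv, hsin]
  linear_combination -Complex.sin (2 * β) * Complex.cos (2 * β) * Complex.exp (-Γ * t / 2) *
    Complex.sin (2 * γ * c s(u, v)) * (∏ i ∈ {u, v}ᶜ, Complex.cos (2 * γ * c s(i, u)) +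
      ∏ i ∈ {u, v}ᶜ, Complex.cos (2 * γ * c s(i, v))) * Complex.I_sq

theorem expectation_couplingOp (c : Sym2 (Fin n) → ℝ) (ρ : Operator n) :
    expectation (couplingOp c) ρ =
      ∑ u, ∑ v ∈ Finset.Ioi u, c s(u, v) * expectation (sigmaZ u * sigmaZ v) ρ := by
  simp only [expectation, couplingOp, Finset.sum_mul, Matrix.trace_sum, smul_mul_assoc,
    Matrix.trace_smul, smul_eq_mul]

end Correlations

end DephasedQAOA

end

open DephasedQAOA in
theorem mainTheorem4 (n : ℕ) (c c' : Sym2 (Fin n) → ℝ) (P : DephasedQAOA.Program n)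
    (hP : DephasedQAOA.Compiles P c') (Γ : ℝ) (hΓ : 0 ≤ Γ) (γ : NNReal) (β t : ℝ)
    (ht : t = (γ : ℝ) * (DephasedQAOA.totalTime P : ℝ)) :
    (∃! ρ, DephasedQAOA.IsQAOAOutput Γ P γ β ρ) ∧
    ∀ ρ, DephasedQAOA.IsQAOAOutput Γ P γ β ρ →
      DephasedQAOA.expectation (DephasedQAOA.couplingOp c) ρ =
        (((∑ u : Fin n, ∑ v ∈ Finset.Ioi u,
            c s(u, v) * Real.sin (4 * β) * Real.sin (2 * γ * c' s(u, v))
                * Real.exp (-Γ * t / 2) / 2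
              * ((∏ μ ∈ ({u, v} : Finset (Fin n))ᶜ, Real.cos (2 * γ * c' s(μ, v)))
                + ∏ μ ∈ ({u, v} : Finset (Fin n))ᶜ, Real.cos (2 * γ * c' s(μ, u))))
          - ∑ u : Fin n, ∑ v ∈ Finset.Ioi u,
            c s(u, v) * Real.sin (2 * β) ^ 2 * Real.exp (-Γ * t) / 2
              * ((∏ μ ∈ ({u, v} : Finset (Fin n))ᶜ,
                    Real.cos (2 * γ * (c' s(μ, u) + c' s(μ, v))))
                - ∏ μ ∈ ({u, v} : Finset (Fin n))ᶜ,
                    Real.cos (2 * γ * (c' s(μ, u) - c' s(μ, v)))) : ℝ) : ℂ) := by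
  simp only [isQAOAOutput_iff hΓ γ β hP, ← ht]
  refine ⟨⟨_, rfl, fun _ h => h⟩, ?_⟩
  rintro _ rfl
  rw [expectation_couplingOp, ← Finset.sum_sub_distrib, Complex.ofReal_sum]
  refine Finset.sum_congr rfl fun u _ => ?_
  rw [← Finset.sum_sub_distrib, Complex.ofReal_sum]
  refine Finset.sum_congr rfl fun v hv => ?_
  rw [expectation_sigmaZ_mul_sigmaZ_mixer_conj_dephasedState Γ γ t β c' (Finset.mem_Ioi.mp hv).ne]
  push_cast
  ring
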